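/- Let $k$ be a nonperfect field of characteristic $2$ and let $K=\bar k$ be an algebraic closure of $k$. Let $G=PGL_2$ (with its standard $k$-structure), regarded through its group of $K$-points. Then $k$ contains a non-square, and for every $a\in k\setminus k^2$ the set $$H=\left\{\overline{\begin{pmatrix} x & ay\\ y & x\end{pmatrix}}\in PGL_2(K)\ :\ x,y\in K,\ x^2-ay^2\neq 0\right\}$$ of images in $PGL_2(K)$ of invertible matrices of this form is a closed, connected, unipotent subgroup of $G$ defined over $k$ such that: $H$ is $G$-irreducible over $k$ (it is contained in no proper parabolic subgroup of $G$ that is defined over $k$); hence $H$ is $G$-completely reducible over $k$ (whenever $H$ is contained in a parabolic subgroup $P$ of $G$ defined over $k$, it is contained in a Levi subgroup of $P$ defined over $k$); but $H$ is not pseudo-reductive, i.e. its $k$-unipotent radical $R_{u,k}(H)$ (the maximal connected unipotent normal subgroup of $H$ that is defined over $k$) is nontrivial. -/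

import Mathlib

open scoped MatrixGroups

/-!
Algebraic groups in the classical language.  `K` is an algebraically closed field containing `k`.
An affine algebraic group with a `k`-structure is given by its group `G` of `K`-points together
with the `k`-algebra `A = k[G]` of those regular functions `G → K` that are defined over `k`; the
algebra of all regular functions is `K[G] = K · k[G]`.  All notions below depend only on `(G, A)`.
-/

namespace AlgGrp

section General

variable {k K G : Type*} [Field k] [Field K] [Algebra k K] [Group G]

/-- The algebra `K[G]` of all regular functions, generated over `K` by `A = k[G]`. -/
def regular (A : Subalgebra k (G → K)) : Subalgebra K (G → K) :=
  Algebra.adjoin K (A : Set (G → K))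

/-- The Zariski topology on `G`: generated by the principal open sets of regular functions. -/
@[reducible]
def zariski (A : Subalgebra k (G → K)) : TopologicalSpace G :=
  TopologicalSpace.generateFrom {U | ∃ f ∈ regular A, U = {g | f g ≠ 0}}

/-- Zariski closed subsets. -/
def IsZClosed (A : Subalgebra k (G → K)) (Z : Set G) : Prop :=
  @IsClosed G (zariski A) Z

/-- Connected subsets in the Zariski topology. -/
def IsZConnected (A : Subalgebra k (G → K)) (Z : Set G) : Prop :=
  @IsConnected G (zariski A) Z

/-- A closed subset `Z` is defined over `k` if the ideal `I(Z)` of regular functions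
vanishing on `Z` is spanned over `K` by `I(Z) ∩ k[G]`. -/
def IsDefinedOver (A : Subalgebra k (G → K)) (Z : Set G) : Prop :=
  IsZClosed A Z ∧
    ∀ f ∈ regular A, (∀ z ∈ Z, f z = 0) →
      f ∈ Submodule.span K {h : G → K | h ∈ A ∧ ∀ z ∈ Z, h z = 0}

/-- Right translation of functions, `(ρ_g f)(x) = f (x g)`. -/
def rightTranslation (K : Type*) [Field K] (g : G) : Module.End K (G → K) :=
  LinearMap.funLeft K K (fun x : G => x * g)

/-- `g` is unipotent if right translation by `g` on `K[G]` is locally unipotent. -/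
def IsUnipotentElement (A : Subalgebra k (G → K)) (g : G) : Prop :=
  ∀ f ∈ regular A, ∃ n : ℕ, ((rightTranslation K g - 1) ^ n) f = 0

/-- A subgroup is unipotent if all its elements are unipotent. -/
def IsUnipotentSubgroup (A : Subalgebra k (G → K)) (H : Subgroup G) : Prop :=
  ∀ g ∈ H, IsUnipotentElement A g

/-- The `k`-unipotent radical `R_{u,k}(H)`: the maximal connected unipotent normal
`k`-subgroup of `H`, obtained as the subgroup generated by all such subgroups. -/
def kUnipotentRadical (A : Subalgebra k (G → K)) (H : Subgroup G) : Subgroup G :=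
  sSup {N : Subgroup G | N ≤ H ∧ (N.subgroupOf H).Normal ∧ IsDefinedOver A (N : Set G) ∧
    IsZConnected A (N : Set G) ∧ IsUnipotentSubgroup A N}

/-- The (geometric) unipotent radical `R_u(H)`, i.e. the unipotent radical over `K`. -/
def unipotentRadical (A : Subalgebra k (G → K)) (H : Subgroup G) : Subgroup G :=
  kUnipotentRadical (regular A) H

/-- A `k`-subgroup `H` is pseudo-reductive if it is connected and `R_{u,k}(H)` is trivial.
(Smoothness is automatic, since `H` is a variety.) -/
def IsPseudoReductive (A : Subalgebra k (G → K)) (H : Subgroup G) : Prop :=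
  IsDefinedOver A (H : Set G) ∧ IsZConnected A (H : Set G) ∧ kUnipotentRadical A H = ⊥

/-- Borel subgroups: maximal closed connected solvable subgroups of `G`. -/
def IsBorel (A : Subalgebra k (G → K)) (B : Subgroup G) : Prop :=
  Maximal (fun B : Subgroup G =>
    IsZClosed A (B : Set G) ∧ IsZConnected A (B : Set G) ∧ Group.IsSolvable B) B

/-- Parabolic subgroups: closed subgroups containing a Borel subgroup. -/
def IsParabolic (A : Subalgebra k (G → K)) (P : Subgroup G) : Prop :=
  IsZClosed A (P : Set G) ∧ ∃ B : Subgroup G, IsBorel A B ∧ B ≤ P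

/-- `k`-parabolic subgroups: parabolic subgroups defined over `k`. -/
def IsKParabolic (A : Subalgebra k (G → K)) (P : Subgroup G) : Prop :=
  IsParabolic A P ∧ IsDefinedOver A (P : Set G)

/-- Levi subgroups of `P`: closed subgroups `L` such that `P = L ⋉ R_u(P)` as algebraic groups.
The last condition says that the projection `P → L` is a morphism of varieties. -/
def IsLevi (A : Subalgebra k (G → K)) (P L : Subgroup G) : Prop :=
  IsZClosed A (L : Set G) ∧ L ⊓ unipotentRadical A P = ⊥ ∧ L ⊔ unipotentRadical A P = P ∧
    ∀ f ∈ regular A, ∃ f' ∈ regular A, ∀ l ∈ L, ∀ u ∈ unipotentRadical A P, f' (l * u) = f l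

/-- `k`-Levi subgroups of `P`: Levi subgroups of `P` defined over `k`. -/
def IsKLevi (A : Subalgebra k (G → K)) (P L : Subgroup G) : Prop :=
  IsLevi A P L ∧ IsDefinedOver A (L : Set G)

/-- `H` is `G`-completely reducible over `k`: whenever `H` is contained in a `k`-parabolic
subgroup `P` of `G`, it is contained in some `k`-Levi subgroup of `P`. -/
def IsCompletelyReducibleOver (A : Subalgebra k (G → K)) (H : Subgroup G) : Prop :=
  ∀ P : Subgroup G, IsKParabolic A P → H ≤ P → ∃ L : Subgroup G, IsKLevi A P L ∧ H ≤ L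

/-- `H` is `G`-irreducible over `k`: it is contained in no proper `k`-parabolic subgroup. -/
def IsIrreducibleOver (A : Subalgebra k (G → K)) (H : Subgroup G) : Prop :=
  ∀ P : Subgroup G, IsKParabolic A P → H ≤ P → P = ⊤

end General

section PGL

variable (k K : Type*) [Field k] [Field K] [Algebra k K] (n : ℕ)

/-- `k[GL_n] = k[x_ij, 1/det]`, as an algebra of functions on `GL_n(K)`. -/
def coordGL : Subalgebra k (GL (Fin n) K → K) :=
  Algebra.adjoin k
    ({f | ∃ i j : Fin n, f = fun g : GL (Fin n) K => (g : Matrix (Fin n) (Fin n) K) i j} ∪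
      {fun g : GL (Fin n) K => ((g : Matrix (Fin n) (Fin n) K).det)⁻¹})

/-- Pullback of functions along `GL_n(K) → PGL_n(K)`. -/
def pullback : (PGL(n, K) → K) →ₐ[k] (GL (Fin n) K → K) :=
  AlgHom.pi fun g =>
    Pi.evalAlgHom k (fun _ => K) (Matrix.ProjGenLinGroup.mk g)

/-- `k[PGL_n] = k[GL_n]^{G_m}`: the functions on `PGL_n(K)` whose pullback to `GL_n(K)`
lies in `k[GL_n]`. -/
def coordPGL : Subalgebra k (PGL(n, K) → K) :=
  (coordGL k K n).comap (pullback k K n)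

end PGL

end AlgGrp

/-! In characteristic 2 a matrix `!![x, a * y; y, x]` has trace `2x = 0`, so by Cayley–Hamilton its
square is scalar. Every element of `H` therefore has square 1, which makes `H` unipotent. `H` is the
image of the invertible part of a linear space parametrized over `k`, hence connected and defined
over `k`. Being nontrivial, it lies in its own `k`-unipotent radical and cannot be pseudo-reductive.

For irreducibility, the proper parabolics of `PGL₂` are the point stabilizers of the projective
line: connected solvable subgroups fix a point (`exists_le_stabilizer_of_isSolvable`), and
stabilizers are maximal subgroups (`isCoatom_stabilizer`). With `α ^ 2 = a`, the only fixed point of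
`H` is `[α : 1]`. Its stabilizer is not defined over `k`, because `α` is purely inseparable over
`k`: a polynomial over `k` vanishing at such a point vanishes there to second order
(`not_isDefinedOver_stabilizer`). So the only `k`-parabolic containing `H` is `PGL₂`, which is its
own Levi subgroup since its unipotent radical is trivial (`unipotentRadical_top`).

Both the fixed point theorem and the triviality of the radical come from
`exists_le_stabilizer_of_commute_conj`. -/

namespace AlgGrp

open Matrix.ProjGenLinGroup (mk mk_surjective mk_eq_mk_iff)

/-! ### The Zariski topology: closed sets, irreducibility and connectedness -/

section Topology

variable {k K G : Type*} [Field k] [Field K] [Algebra k K]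

theorem isZClosed_zeroLocus {A : Subalgebra k (G → K)} (S : Set (G → K))
    (hS : S ⊆ regular A) : IsZClosed A {g | ∀ f ∈ S, f g = 0} := by
  let := zariski A
  have : {g | ∀ f ∈ S, f g = 0} = ⋂ f ∈ S, {g : G | f g ≠ 0}ᶜ := by ext; simp
  unfold IsZClosed
  rw [this]
  refine isClosed_biInter fun f hf => ?_
  rw [isClosed_compl_iff]
  exact TopologicalSpace.isOpen_generateFrom_of_mem ⟨f, hS hf, rfl⟩

theorem isTopologicalBasis_zariski (A : Subalgebra k (G → K)) :
    @TopologicalSpace.IsTopologicalBasis G (zariski A)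
      {U | ∃ f ∈ regular A, U = {g | f g ≠ 0}} := by
  let := zariski A
  refine ⟨?_, ?_, rfl⟩
  · rintro _ ⟨f, hf, rfl⟩ _ ⟨f', hf', rfl⟩ x hx
    refine ⟨_, ⟨f * f', mul_mem hf hf', rfl⟩, ?_, ?_⟩
    · exact mul_ne_zero hx.1 hx.2
    · intro y hy
      exact ⟨left_ne_zero_of_mul hy, right_ne_zero_of_mul hy⟩
  · refine Set.eq_univ_of_forall fun x => ⟨_, ⟨1, one_mem _, rfl⟩, ?_⟩
    simp

theorem isZConnected_of_forall_mul_ne_zero {A : Subalgebra k (G → K)} {Z : Set G}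
    (hne : Z.Nonempty)
    (h : ∀ f ∈ regular A, ∀ f' ∈ regular A, (∃ z ∈ Z, f z ≠ 0) → (∃ z ∈ Z, f' z ≠ 0) →
      ∃ z ∈ Z, f z ≠ 0 ∧ f' z ≠ 0) : IsZConnected A Z := by
  let := zariski A
  refine ⟨hne, IsPreirreducible.isPreconnected ?_⟩
  rintro U V hU hV ⟨x, hxZ, hxU⟩ ⟨y, hyZ, hyV⟩
  obtain ⟨_, ⟨f, hf, rfl⟩, hx, hfU⟩ :=
    (isTopologicalBasis_zariski A).exists_subset_of_mem_open hxU hU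
  obtain ⟨_, ⟨f', hf', rfl⟩, hy, hfV⟩ :=
    (isTopologicalBasis_zariski A).exists_subset_of_mem_open hyV hV
  obtain ⟨z, hz, h1, h2⟩ := h f hf f' hf' ⟨x, hxZ, hx⟩ ⟨y, hyZ, hy⟩
  exact ⟨z, hz, hfU h1, hfV h2⟩

theorem subset_of_isZConnected {A : Subalgebra k (G → K)} {S Z Z' : Set G}
    (hS : IsZConnected A S) (hZ : IsZClosed A Z) (hZ' : IsZClosed A Z') (hsub : S ⊆ Z ∪ Z')
    (hdisj : Disjoint Z Z') (hne : (S ∩ Z).Nonempty) : S ⊆ Z := by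
  let := zariski A
  have h := isPreconnected_closed_iff.mp hS.isPreconnected Z Z' hZ hZ' hsub hne
  intro s hs
  by_contra hsZ
  obtain ⟨x, -, hx⟩ := h ⟨s, hs, (hsub hs).resolve_left hsZ⟩
  exact hdisj.le_bot hx

theorem mem_regular_of_mem {A : Subalgebra k (G → K)} {f : G → K} (hf : f ∈ A) :
    f ∈ regular A := Algebra.subset_adjoin hf

theorem regular_eq_span (A : Subalgebra k (G → K)) :
    Subalgebra.toSubmodule (regular A) = Submodule.span K (A : Set (G → K)) := by
  have : Submonoid.closure (A : Set (G → K)) = A.toSubmonoid :=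
    Submonoid.closure_eq A.toSubmonoid
  rw [regular, Algebra.adjoin_eq_span, this]
  rfl

end Topology

/-! ### Pulling regular functions back to families of matrices -/

section Eval

variable {k K : Type*} [Field k] [Field K] [Algebra k K] {n : ℕ}

/-- A power of the determinant clears the denominators. The exponent and the numerator in `R` serve
all specializations `e` at once. -/
theorem exists_eval_eq_of_mem_coordGL {R : Type*} [CommRing R] [Algebra k R]
    (φ : Matrix (Fin n) (Fin n) R) {f : GL (Fin n) K → K} (hf : f ∈ coordGL k K n) :
    ∃ (N : ℕ) (r : R), ∀ (e : R →ₐ[k] K) (g : GL (Fin n) K),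
      (g : Matrix (Fin n) (Fin n) K) = φ.map e → f g * g.val.det ^ N = e r := by
  have hdet : ∀ (e : R →ₐ[k] K) (g : GL (Fin n) K),
      (g : Matrix (Fin n) (Fin n) K) = φ.map e → g.val.det = e φ.det := by
    intro e g h
    rw [h, AlgHom.map_det]
    rfl
  induction hf using Algebra.adjoin_induction with
  | mem f hf =>
    rcases hf with ⟨i, j, rfl⟩ | rfl
    · exact ⟨0, φ i j, fun e g h => by simp [h]⟩
    · refine ⟨1, 1, fun e g h => ?_⟩
      have : g.val.det ≠ 0 := ((Matrix.isUnit_iff_isUnit_det _).mp g.isUnit).ne_zero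
      simp only [pow_one, map_one]
      exact inv_mul_cancel₀ this
  | algebraMap c => exact ⟨0, algebraMap k R c, fun e g h => by simp⟩
  | add f f' _ _ h h' =>
    obtain ⟨N, r, hr⟩ := h
    obtain ⟨N', r', hr'⟩ := h'
    refine ⟨N + N', r * φ.det ^ N' + r' * φ.det ^ N, fun e g h => ?_⟩
    rw [map_add, map_mul, map_mul, map_pow, map_pow, ← hr e g h, ← hr' e g h, ← hdet e g h,
      Pi.add_apply]
    ring
  | mul f f' _ _ h h' =>
    obtain ⟨N, r, hr⟩ := h
    obtain ⟨N', r', hr'⟩ := h'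
    refine ⟨N + N', r * r', fun e g h => ?_⟩
    rw [map_mul, ← hr e g h, ← hr' e g h, Pi.mul_apply]
    ring

theorem exists_eval_eq_of_mem_coordPGL {R : Type*} [CommRing R] [Algebra k R]
    (φ : Matrix (Fin n) (Fin n) R) {f : PGL(n, K) → K} (hf : f ∈ coordPGL k K n) :
    ∃ (N : ℕ) (r : R), ∀ (e : R →ₐ[k] K) (g : GL (Fin n) K),
      (g : Matrix (Fin n) (Fin n) K) = φ.map e → f (mk g) * g.val.det ^ N = e r :=
  exists_eval_eq_of_mem_coordGL φ (f := pullback k K n f) hf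

theorem exists_eval_eq_of_mem_regular {R : Type*} [CommRing R] [Algebra K R]
    (φ : Matrix (Fin n) (Fin n) R) {f : PGL(n, K) → K} (hf : f ∈ regular (coordPGL k K n)) :
    ∃ (N : ℕ) (r : R), ∀ (e : R →ₐ[K] K) (g : GL (Fin n) K),
      (g : Matrix (Fin n) (Fin n) K) = φ.map e → f (mk g) * g.val.det ^ N = e r := by
  refine exists_eval_eq_of_mem_coordPGL (k := K) φ ?_
  refine (Algebra.adjoin_le (S := coordPGL K K n) ?_ : regular (coordPGL k K n) ≤ _) hf
  intro f hf
  have hf : pullback k K n f ∈ coordGL k K n := hf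
  change pullback K K n f ∈ coordGL K K n
  have h : coordGL k K n ≤ (coordGL K K n).restrictScalars k :=
    Algebra.adjoin_le Algebra.subset_adjoin
  exact h hf

/-- Two points are joined by the line `M + t (M' - M)` inside `V`. Two functions not vanishing at
its respective ends pull back to nonzero polynomials in `t`, and over an infinite field these and
the determinant have a common non-root. Thus `Z` is irreducible. -/
theorem isZConnected_of_submodule [Infinite K] (V : Submodule K (Matrix (Fin n) (Fin n) K))
    {Z : Set PGL(n, K)} (hZ : ∀ M : GL (Fin n) K, mk M ∈ Z ↔ M.val ∈ V) (hne : Z.Nonempty) :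
    IsZConnected (coordPGL k K n) Z := by
  refine isZConnected_of_forall_mul_ne_zero hne ?_
  rintro f hf f' hf' ⟨z, hz, hfz⟩ ⟨z', hz', hfz'⟩
  obtain ⟨M, rfl⟩ := mk_surjective z
  obtain ⟨M', rfl⟩ := mk_surjective z'
  rw [hZ] at hz hz'
  let φ : Matrix (Fin n) (Fin n) (Polynomial K) :=
    M.val.map Polynomial.C + (Polynomial.X : Polynomial K) • (M'.val - M.val).map Polynomial.C
  have hφ : ∀ t : K, φ.map (Polynomial.aeval t) = M.val + t • (M'.val - M.val) := by
    intro t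
    ext i j
    simp [φ]
  have hdet : ∀ t : K, Polynomial.aeval t φ.det = (M.val + t • (M'.val - M.val)).det := by
    intro t
    rw [← hφ, AlgHom.map_det]
    rfl
  have hM0 : M.val.det ≠ 0 := ((Matrix.isUnit_iff_isUnit_det _).mp M.isUnit).ne_zero
  have hM0' : M'.val.det ≠ 0 := ((Matrix.isUnit_iff_isUnit_det _).mp M'.isUnit).ne_zero
  obtain ⟨N, r, hr⟩ := exists_eval_eq_of_mem_regular φ hf
  obtain ⟨N', r', hr'⟩ := exists_eval_eq_of_mem_regular φ hf'
  have e0 := hr (Polynomial.aeval 0) M (by rw [hφ]; simp)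
  have e1 := hr' (Polynomial.aeval 1) M' (by rw [hφ]; simp)
  have hr0 : r ≠ 0 := by
    rintro rfl
    rw [map_zero] at e0
    exact mul_ne_zero hfz (pow_ne_zero _ hM0) e0
  have hr0' : r' ≠ 0 := by
    rintro rfl
    rw [map_zero] at e1
    exact mul_ne_zero hfz' (pow_ne_zero _ hM0') e1
  have hφ0 : φ.det ≠ 0 := by
    intro h
    have := hdet 0
    rw [h, map_zero] at this
    simp at this
    exact hM0 this.symm
  obtain ⟨t, ht⟩ : ∃ t : K, (r * r' * φ.det).eval t ≠ 0 := by
    by_contra! h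
    exact mul_ne_zero (mul_ne_zero hr0 hr0') hφ0 (Polynomial.funext fun t => by simpa using h t)
  simp only [Polynomial.eval_mul] at ht
  have hdt : (M.val + t • (M'.val - M.val)).det ≠ 0 := by
    rw [← hdet, Polynomial.aeval_def, Polynomial.eval₂_eq_eval_map]
    simpa using right_ne_zero_of_mul ht
  let g : GL (Fin n) K := Matrix.GeneralLinearGroup.mkOfDetNeZero _ hdt
  have hg : g.val = φ.map (Polynomial.aeval t) := (hφ t).symm
  have h1 := hr (Polynomial.aeval t) g hg
  have h2 := hr' (Polynomial.aeval t) g hg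
  refine ⟨mk g, (hZ g).mpr ?_, ?_, ?_⟩
  · exact V.add_mem hz (V.smul_mem _ (V.sub_mem hz' hz))
  · intro h
    rw [h, zero_mul] at h1
    exact left_ne_zero_of_mul (left_ne_zero_of_mul ht) (by simpa [Polynomial.aeval_def] using h1.symm)
  · intro h
    rw [h, zero_mul] at h2
    exact right_ne_zero_of_mul (left_ne_zero_of_mul ht) (by simpa [Polynomial.aeval_def] using h2.symm)

end Eval

/-! ### Explicit regular functions and closed sets in `PGL₂` -/

section PGL2

variable {k K : Type*} [Field k] [Field K] [Algebra k K]

theorem det_ne_zero (M : GL (Fin 2) K) : M.val.det ≠ 0 :=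
  ((Matrix.isUnit_iff_isUnit_det _).mp M.isUnit).ne_zero

theorem mk_eq_mk_iff_smul {M N : GL (Fin 2) K} :
    mk M = mk N ↔ ∃ c : K, c ≠ 0 ∧ N.val = c • M.val := by
  rw [mk_eq_mk_iff]
  constructor
  · rintro ⟨u, rfl⟩
    refine ⟨u, u.ne_zero, ?_⟩
    ext i j
    simp [mul_comm]
  · rintro ⟨c, hc, h⟩
    refine ⟨Units.mk0 c hc, ?_⟩
    ext i j
    simp [h, mul_comm]

/-- The regular function `x_{ij} x_{lm} / det` on `PGL₂`. -/
noncomputable def quadFn (K : Type*) [Field K] (i j l m : Fin 2) (g : PGL(2, K)) : K :=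
  (Function.surjInv mk_surjective g : GL (Fin 2) K).val i j *
    (Function.surjInv mk_surjective g : GL (Fin 2) K).val l m *
    ((Function.surjInv mk_surjective g : GL (Fin 2) K).val.det)⁻¹

theorem quadFn_mk (i j l m : Fin 2) (M : GL (Fin 2) K) :
    quadFn K i j l m (mk M) = M.val i j * M.val l m * (M.val.det)⁻¹ := by
  obtain ⟨c, hc, h⟩ := mk_eq_mk_iff_smul.mp (Function.surjInv_eq mk_surjective (mk M))
  have hd := det_ne_zero (Function.surjInv mk_surjective (mk M) : GL (Fin 2) K)
  rw [quadFn, h]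
  simp only [Matrix.det_smul, Matrix.smul_apply, smul_eq_mul, Fintype.card_fin]
  field_simp

theorem quadFn_mem (i j l m : Fin 2) : quadFn K i j l m ∈ coordPGL k K 2 := by
  change pullback k K 2 (quadFn K i j l m) ∈ coordGL k K 2
  have : pullback k K 2 (quadFn K i j l m) =
      (fun g : GL (Fin 2) K => g.val i j) * (fun g : GL (Fin 2) K => g.val l m) *
        (fun g : GL (Fin 2) K => (g.val.det)⁻¹) := by
    funext g
    exact quadFn_mk i j l m g
  rw [this]
  exact mul_mem (mul_mem (Algebra.subset_adjoin (Or.inl ⟨i, j, rfl⟩))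
    (Algebra.subset_adjoin (Or.inl ⟨l, m, rfl⟩))) (Algebra.subset_adjoin (Or.inr rfl))

theorem quadFn_mem_regular (i j l m : Fin 2) : quadFn K i j l m ∈ regular (coordPGL k K 2) :=
  mem_regular_of_mem (quadFn_mem i j l m)

/-- A linear form is not a function on `PGL₂`, but its product with any entry, divided by the
determinant, is. Some entry is nonzero, so these products vanish together exactly when the form
does. -/
theorem isZClosed_of_linear (a b c d : K) {Z : Set PGL(2, K)}
    (hZ : ∀ M : GL (Fin 2) K,
      mk M ∈ Z ↔ a * M.val 0 0 + b * M.val 0 1 + c * M.val 1 0 + d * M.val 1 1 = 0) :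
    IsZClosed (coordPGL k K 2) Z := by
  let F : Fin 2 × Fin 2 → PGL(2, K) → K := fun p =>
    a • quadFn K 0 0 p.1 p.2 + b • quadFn K 0 1 p.1 p.2 + c • quadFn K 1 0 p.1 p.2 +
      d • quadFn K 1 1 p.1 p.2
  have hF : ∀ p (M : GL (Fin 2) K), F p (mk M) =
      (a * M.val 0 0 + b * M.val 0 1 + c * M.val 1 0 + d * M.val 1 1) * M.val p.1 p.2 *
        (M.val.det)⁻¹ := by
    intro p M
    simp only [F, Pi.add_apply, Pi.smul_apply, quadFn_mk, smul_eq_mul]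
    ring
  convert isZClosed_zeroLocus (A := coordPGL k K 2) (Set.range F) ?_ using 1
  · ext z
    obtain ⟨M, rfl⟩ := mk_surjective z
    rw [hZ]
    simp only [Set.mem_ofPred_eq, Set.forall_mem_range, hF]
    constructor
    · intro h p
      rw [h, zero_mul, zero_mul]
    · intro h
      by_contra h0
      have : M.val = 0 := by
        ext i j
        have := h (i, j)
        simpa [h0, det_ne_zero M] using this
      exact det_ne_zero M (by rw [this]; simp)
  · rintro _ ⟨p, rfl⟩
    exact add_mem (add_mem (add_mem (Subalgebra.smul_mem _ (quadFn_mem_regular _ _ _ _) _)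
      (Subalgebra.smul_mem _ (quadFn_mem_regular _ _ _ _) _))
      (Subalgebra.smul_mem _ (quadFn_mem_regular _ _ _ _) _))
      (Subalgebra.smul_mem _ (quadFn_mem_regular _ _ _ _) _)

end PGL2

open scoped LinearAlgebra.Projectivization

/-! ### Point stabilizers on the projective line -/

section Stabilizer

variable {k K : Type*} [Field k] [Field K] [Algebra k K]

theorem exists_eq_smul_of_cross_eq_zero {v u : Fin 2 → K} (hv : v ≠ 0)
    (h : v 0 * u 1 - v 1 * u 0 = 0) : ∃ c : K, u = c • v := by
  by_cases h0 : v 0 = 0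
  · have h1 : v 1 ≠ 0 := by
      intro h1
      exact hv (by ext i; fin_cases i <;> simp [h0, h1])
    refine ⟨u 1 / v 1, ?_⟩
    have hu : u 0 = 0 := by simpa [h0, h1] using h
    ext i
    fin_cases i
    · simp [h0, hu]
    · simp [h1]
  · refine ⟨u 0 / v 0, ?_⟩
    ext i
    fin_cases i
    · simp [h0]
    · simp only [Fin.mk_one, Pi.smul_apply, smul_eq_mul]
      field_simp
      linear_combination h

theorem mulVec_ne_zero (M : GL (Fin 2) K) {v : Fin 2 → K} (hv : v ≠ 0) :
    M.val.mulVec v ≠ 0 :=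
  fun h => hv (Matrix.eq_zero_of_mulVec_eq_zero (det_ne_zero M) h)

theorem mk_mem_stabilizer_iff {v : Fin 2 → K} (hv : v ≠ 0) (M : GL (Fin 2) K) :
    mk M ∈ MulAction.stabilizer PGL(2, K) (Projectivization.mk K v hv) ↔
      v 0 * (M.val.mulVec v) 1 - v 1 * (M.val.mulVec v) 0 = 0 := by
  rw [MulAction.mem_stabilizer_iff, Projectivization.PGL.mk_smul_mk,
    Projectivization.mk_eq_mk_iff']
  constructor
  · rintro ⟨c, hc⟩
    have hc : c • v = M.val.mulVec v := hc
    rw [← hc]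
    simp only [Pi.smul_apply, smul_eq_mul]
    ring
  · intro h
    obtain ⟨c, hc⟩ := exists_eq_smul_of_cross_eq_zero hv h
    exact ⟨c, hc.symm⟩

theorem mk_mem_stabilizer_iff_exists {v : Fin 2 → K} (hv : v ≠ 0) (M : GL (Fin 2) K) :
    mk M ∈ MulAction.stabilizer PGL(2, K) (Projectivization.mk K v hv) ↔
      ∃ c : K, M.val.mulVec v = c • v := by
  rw [MulAction.mem_stabilizer_iff, Projectivization.PGL.mk_smul_mk,
    Projectivization.mk_eq_mk_iff']
  exact exists_congr fun c => eq_comm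

theorem isZClosed_stabilizer (p : ℙ K (Fin 2 → K)) :
    IsZClosed (coordPGL k K 2) (MulAction.stabilizer PGL(2, K) p : Set PGL(2, K)) := by
  induction p using Projectivization.ind with | _ v hv =>
  refine isZClosed_of_linear (-(v 1 * v 0)) (-(v 1 * v 1)) (v 0 * v 0) (v 0 * v 1) fun M => ?_
  rw [SetLike.mem_coe, mk_mem_stabilizer_iff hv]
  simp only [Matrix.mulVec, dotProduct, Fin.sum_univ_two]
  ring_nf

theorem isZConnected_stabilizer [Infinite K] (p : ℙ K (Fin 2 → K)) :
    IsZConnected (coordPGL k K 2) (MulAction.stabilizer PGL(2, K) p : Set PGL(2, K)) := by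
  induction p using Projectivization.ind with | _ v hv =>
  let L : Matrix (Fin 2) (Fin 2) K →ₗ[K] K :=
    { toFun := fun M => v 0 * (M.mulVec v) 1 - v 1 * (M.mulVec v) 0
      map_add' := fun M N => by simp only [Matrix.add_mulVec, Pi.add_apply]; ring
      map_smul' := fun c M => by
        simp only [Matrix.smul_mulVec, Pi.smul_apply, smul_eq_mul, RingHom.id_apply]; ring }
  exact isZConnected_of_submodule (LinearMap.ker L)
    (fun M => (mk_mem_stabilizer_iff hv M).trans (LinearMap.mem_ker (f := L)).symm)
    ⟨1, one_mem _⟩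

instance isMultiplyPretransitive_PGL :
    MulAction.IsMultiplyPretransitive PGL(2, K) (ℙ K (Fin 2 → K)) 2 :=
  let f : ℙ K (Fin 2 → K) →ₑ[(Matrix.SpecialLinearGroup.toPGL :
      Matrix.SpecialLinearGroup (Fin 2) K →* PGL(2, K))] ℙ K (Fin 2 → K) :=
    { toFun := id
      map_smul' := fun g p => by
        induction p using Projectivization.ind with | _ v hv => rfl }
  MulAction.IsPretransitive.of_embedding (f := f) Function.surjective_id

instance nontrivial_projectiveLine : Nontrivial (ℙ K (Fin 2 → K)) := by
  refine ⟨Projectivization.mk K ![1, 0] (by simp), Projectivization.mk K ![0, 1] (by simp), ?_⟩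
  rw [Ne, Projectivization.mk_eq_mk_iff']
  rintro ⟨c, hc⟩
  simpa using congrFun hc 0

/-- A 2-transitive action is primitive. -/
theorem isCoatom_stabilizer (p : ℙ K (Fin 2 → K)) :
    IsCoatom (MulAction.stabilizer PGL(2, K) p) := by
  have : MulAction.IsPreprimitive PGL(2, K) (ℙ K (Fin 2 → K)) :=
    MulAction.isPreprimitive_of_is_two_pretransitive inferInstance
  exact MulAction.IsPreprimitive.isCoatom_stabilizer_of_isPreprimitive _ p

theorem isSolvable_stabilizer (p : ℙ K (Fin 2 → K)) :
    Group.IsSolvable (MulAction.stabilizer PGL(2, K) p) := by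
  let e : ℙ K (Fin 2 → K) := Projectivization.mk K ![1, 0] (by simp)
  have htrans : MulAction.IsPretransitive PGL(2, K) (ℙ K (Fin 2 → K)) :=
    MulAction.isPretransitive_of_is_two_pretransitive
  suffices h : Group.IsSolvable (MulAction.stabilizer PGL(2, K) e) by
    obtain ⟨g, hg⟩ := htrans.exists_smul_eq p e
    exact Group.isSolvable_of_isSolvable_injective
      (f := (MulAction.stabilizerEquivStabilizer hg.symm).toMonoidHom)
      (MulAction.stabilizerEquivStabilizer hg.symm).injective
  have hmem : ∀ M : GL (Fin 2) K, mk M ∈ MulAction.stabilizer PGL(2, K) e ↔ M.val 1 0 = 0 := by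
    intro M
    rw [mk_mem_stabilizer_iff]
    simp [Matrix.mulVec, dotProduct]
  -- On upper triangular matrices `x₀₀ ^ 2 / det = x₀₀ / x₁₁`, the character whose kernel is the
  -- commutative group of translations.
  let χ : MulAction.stabilizer PGL(2, K) e →* K :=
    { toFun := fun g => quadFn K 0 0 0 0 g.1
      map_one' := by
        have := quadFn_mk 0 0 0 0 (1 : GL (Fin 2) K)
        simpa using this
      map_mul' := by
        rintro ⟨g, hg⟩ ⟨g', hg'⟩
        obtain ⟨M, rfl⟩ := mk_surjective g
        obtain ⟨M', rfl⟩ := mk_surjective g'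
        rw [hmem] at hg hg'
        change quadFn K 0 0 0 0 (mk M * mk M') = _
        rw [← map_mul]
        simp only [quadFn_mk, Units.val_mul, Matrix.det_mul, Matrix.mul_apply, Fin.sum_univ_two,
          hg', mul_zero, add_zero, mul_inv]
        ring }
  have hcomm : ∀ a b : χ.toHomUnits.ker, a * b = b * a := by
    rintro ⟨⟨g, hg⟩, hgk⟩ ⟨⟨g', hg'⟩, hgk'⟩
    have hgk : quadFn K 0 0 0 0 g = 1 := congrArg Units.val (MonoidHom.mem_ker.mp hgk)
    have hgk' : quadFn K 0 0 0 0 g' = 1 := congrArg Units.val (MonoidHom.mem_ker.mp hgk')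
    apply Subtype.ext
    apply Subtype.ext
    change g * g' = g' * g
    obtain ⟨M, rfl⟩ := mk_surjective g
    obtain ⟨M', rfl⟩ := mk_surjective g'
    rw [hmem] at hg hg'
    have key : ∀ M : GL (Fin 2) K, M.val 1 0 = 0 → quadFn K 0 0 0 0 (mk M) = 1 →
        M.val 0 0 = M.val 1 1 := by
      intro M h0 h
      have hd := det_ne_zero M
      rw [quadFn_mk, mul_inv_eq_one₀ hd, Matrix.det_fin_two, h0, mul_zero, sub_zero] at h
      rw [Matrix.det_fin_two, h0, mul_zero, sub_zero] at hd
      exact mul_left_cancel₀ (left_ne_zero_of_mul hd) h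
    have h := key M hg hgk
    have h' := key M' hg' hgk'
    rw [← map_mul, ← map_mul]
    congr 1
    ext i j
    fin_cases i <;> fin_cases j <;>
      simp [Matrix.mul_apply, Fin.sum_univ_two, hg, hg', h, h'] <;> ring
  have := Group.isSolvable_of_comm hcomm
  exact Group.isSolvable_of_ker_le_range χ.toHomUnits.ker.subtype χ.toHomUnits (by simp)

theorem eq_smul_of_eigenvector {X : GL (Fin 2) K} (hX : mk X ≠ 1) {v u : Fin 2 → K} {c : K}
    (hv0 : v ≠ 0) (hv : X.val.mulVec v = c • v) (hu : X.val.mulVec u = c • u) :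
    ∃ d : K, u = d • v := by
  refine exists_eq_smul_of_cross_eq_zero hv0 ?_
  by_contra h
  apply hX
  have v0 := congrFun hv 0
  have v1 := congrFun hv 1
  have u0 := congrFun hu 0
  have u1 := congrFun hu 1
  simp only [Matrix.mulVec, dotProduct, Fin.sum_univ_two, Pi.smul_apply, smul_eq_mul] at v0 v1 u0 u1
  -- If `v` and `u` were independent, Cramer's rule would force `X` to be the scalar `c`.
  have h00 : X.val 0 0 = c := mul_left_cancel₀ h (by linear_combination u 1 * v0 - v 1 * u0)
  have h01 : X.val 0 1 = 0 := mul_left_cancel₀ h (by linear_combination v 0 * u0 - u 0 * v0)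
  have h10 : X.val 1 0 = 0 := mul_left_cancel₀ h (by linear_combination u 1 * v1 - v 1 * u1)
  have h11 : X.val 1 1 = c := mul_left_cancel₀ h (by linear_combination v 0 * u1 - u 0 * v1)
  have hc : c ≠ 0 := by
    rintro rfl
    exact det_ne_zero X (by rw [Matrix.det_fin_two, h00, h01]; simp)
  rw [← map_one mk, eq_comm, mk_eq_mk_iff_smul]
  refine ⟨c, hc, ?_⟩
  ext i j
  fin_cases i <;> fin_cases j <;> simp [h00, h01, h10, h11]

end Stabilizer

/-! ### Fixed points of connected solvable groups, and parabolic subgroups -/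

section CharTwo

variable {k K : Type*} [Field k] [Field K] [Algebra k K] [CharP K 2]

/-- From `N M = c M N`, determinants give `c ^ 2 = 1`, which in characteristic 2 leaves only `c =
1`. -/
theorem commute_of_commute_mk {M N : GL (Fin 2) K} (h : Commute (mk M) (mk N)) :
    Commute M N := by
  have h : mk (M * N) = mk (N * M) := by rw [map_mul, map_mul]; exact h
  obtain ⟨c, -, hc⟩ := mk_eq_mk_iff_smul.mp h
  have hd := congrArg Matrix.det hc
  rw [Matrix.det_smul, Units.val_mul, Units.val_mul, Matrix.det_mul, Matrix.det_mul,
    Fintype.card_fin, mul_comm] at hd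
  have h1 : c ^ 2 = 1 := by
    have := mul_ne_zero (det_ne_zero M) (det_ne_zero N)
    exact mul_right_cancel₀ this (by rw [one_mul]; exact hd.symm)
  have h2 : c = 1 := by
    have : (c - 1) ^ 2 = 0 := by
      rw [sub_sq, h1]
      linear_combination (1 - c) * CharTwo.two_eq_zero (R := K)
    exact sub_eq_zero.mp (pow_eq_zero_iff two_ne_zero |>.mp this)
  rw [h2, one_smul] at hc
  exact Units.ext hc.symm

/-- Let `v` be an eigenvector of a lift `X` of `d`. As `Y⁻¹XY` commutes with `X`, it preserves the
eigenline of `v`, so `Yv` is again an eigenvector of `X`. There are at most two eigenlines, and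
connectedness of `S` keeps `Yv` on the line of `v`. -/
theorem exists_le_stabilizer_of_commute_conj [IsAlgClosed K] {S : Subgroup PGL(2, K)}
    (hS : IsZConnected (coordPGL k K 2) (S : Set PGL(2, K))) {d : PGL(2, K)} (hd : d ≠ 1)
    (hcomm : ∀ s ∈ S, Commute (s⁻¹ * d * s) d) :
    ∃ p : ℙ K (Fin 2 → K), S ≤ MulAction.stabilizer PGL(2, K) p := by
  obtain ⟨X, rfl⟩ := mk_surjective d
  obtain ⟨c, hc⟩ := Module.End.exists_eigenvalue (Matrix.toLin' X.val)
  obtain ⟨v, hv⟩ := hc.exists_hasEigenvector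
  have hv0 : v ≠ 0 := hv.2
  have hXv : X.val.mulVec v = c • v := by simpa using hv.apply_eq_smul
  refine ⟨Projectivization.mk K v hv0, ?_⟩
  have hconj : ∀ Y : GL (Fin 2) K, mk Y ∈ S →
      ∃ b : K, X.val.mulVec (Y.val.mulVec v) = b • Y.val.mulVec v := by
    intro Y hY
    have h := hcomm _ hY
    rw [← map_inv, ← map_mul, ← map_mul] at h
    have h := commute_of_commute_mk h
    have h1 : X.val.mulVec ((Y⁻¹ * X * Y).val.mulVec v) = c • (Y⁻¹ * X * Y).val.mulVec v := by
      rw [Matrix.mulVec_mulVec, ← Units.val_mul, ← h.eq, Units.val_mul, ← Matrix.mulVec_mulVec,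
        hXv, Matrix.mulVec_smul]
    obtain ⟨b, hb⟩ := eq_smul_of_eigenvector hd hv0 hXv h1
    refine ⟨b, ?_⟩
    rw [← Matrix.mulVec_smul, ← hb, Matrix.mulVec_mulVec, Matrix.mulVec_mulVec, ← Units.val_mul,
      ← Units.val_mul]
    congr 2
    group
  -- the second root of the characteristic polynomial of `X`
  let c' : K := X.val 0 0 + X.val 1 1 - c
  have hroot : ∀ (u : Fin 2 → K) (b : K), u ≠ 0 → X.val.mulVec u = b • u →
      b ^ 2 - (X.val 0 0 + X.val 1 1) * b + X.val.det = 0 := by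
    intro u b hu hb
    have h0 := congrFun hb 0
    have h1 := congrFun hb 1
    simp only [Matrix.mulVec, dotProduct, Fin.sum_univ_two, Pi.smul_apply, smul_eq_mul] at h0 h1
    rw [Matrix.det_fin_two]
    by_cases hu0 : u 0 = 0
    · have hu1 : u 1 ≠ 0 := by
        intro hu1
        exact hu (by ext i; fin_cases i <;> simp [hu0, hu1])
      refine mul_left_cancel₀ hu1 ?_
      linear_combination (X.val 0 0 - b) * h1 - X.val 1 0 * h0
    · refine mul_left_cancel₀ hu0 ?_
      linear_combination (X.val 1 1 - b) * h0 - X.val 0 1 * h1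
  have hcc : ∀ (u : Fin 2 → K) (b : K), u ≠ 0 → X.val.mulVec u = b • u → b = c ∨ b = c' := by
    intro u b hu hb
    have h1 := hroot u b hu hb
    have h2 := hroot v c hv0 hXv
    have : (b - c) * (b - c') = 0 := by
      simp only [c']
      linear_combination h1 - h2
    rcases mul_eq_zero.mp this with h | h
    · exact Or.inl (sub_eq_zero.mp h)
    · exact Or.inr (sub_eq_zero.mp h)
  have hfix : ∀ Y : GL (Fin 2) K, X.val.mulVec (Y.val.mulVec v) = c • Y.val.mulVec v →
      mk Y ∈ MulAction.stabilizer PGL(2, K) (Projectivization.mk K v hv0) := by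
    intro Y hY
    rw [mk_mem_stabilizer_iff_exists hv0]
    exact eq_smul_of_eigenvector hd hv0 hXv hY
  by_cases hne : c' = c
  · intro s hs
    obtain ⟨Y, rfl⟩ := mk_surjective s
    obtain ⟨b, hb⟩ := hconj Y hs
    have : b = c := by
      rcases hcc _ b (mulVec_ne_zero Y hv0) hb with h | h
      · exact h
      · rw [h, hne]
    exact hfix Y (this ▸ hb)
  -- The condition that `Yv` has eigenvalue `c'` is split into its two coordinates, each a single
  -- linear equation in `Y`.
  · let Z : Fin 2 → Set PGL(2, K) := fun i => {s | ∃ Y : GL (Fin 2) K, mk Y = s ∧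
      X.val.mulVec (Y.val.mulVec v) i = c' * Y.val.mulVec v i}
    have hZ : ∀ i (Y : GL (Fin 2) K), mk Y ∈ Z i ↔
        X.val.mulVec (Y.val.mulVec v) i = c' * Y.val.mulVec v i := by
      intro i Y
      constructor
      · rintro ⟨Y', h, h'⟩
        obtain ⟨a, ha, h⟩ := mk_eq_mk_iff_smul.mp h
        rw [h, Matrix.smul_mulVec, Matrix.mulVec_smul, Pi.smul_apply, Pi.smul_apply, h']
        simp only [smul_eq_mul]
        ring
      · exact fun h => ⟨Y, rfl, h⟩
    have hZc : ∀ i, IsZClosed (coordPGL k K 2) (Z i) := by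
      intro i
      refine isZClosed_of_linear ((X.val i 0 - c' * (1 : Matrix (Fin 2) (Fin 2) K) i 0) * v 0)
        ((X.val i 0 - c' * (1 : Matrix (Fin 2) (Fin 2) K) i 0) * v 1)
        ((X.val i 1 - c' * (1 : Matrix (Fin 2) (Fin 2) K) i 1) * v 0)
        ((X.val i 1 - c' * (1 : Matrix (Fin 2) (Fin 2) K) i 1) * v 1) fun Y => ?_
      rw [hZ, ← sub_eq_zero]
      refine Eq.congr_left ?_
      obtain rfl | rfl : i = 0 ∨ i = 1 := by omega
      all_goals
        simp [Matrix.mulVec, dotProduct, Fin.sum_univ_two]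
        ring
    refine subset_of_isZConnected hS (isZClosed_stabilizer _)
      (Z' := Z 0 ∩ Z 1) ?_ ?_ ?_ ⟨1, one_mem _, one_mem _⟩
    · let := zariski (coordPGL k K 2)
      exact IsClosed.inter (hZc 0) (hZc 1)
    · intro s hs
      obtain ⟨Y, rfl⟩ := mk_surjective s
      obtain ⟨b, hb⟩ := hconj Y hs
      rcases hcc _ b (mulVec_ne_zero Y hv0) hb with h | h
      · exact Or.inl (hfix Y (h ▸ hb))
      · rw [h] at hb
        exact Or.inr ⟨(hZ 0 Y).mpr (congrFun hb 0), (hZ 1 Y).mpr (congrFun hb 1)⟩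
    · rw [Set.disjoint_left]
      rintro s hs ⟨h0, h1⟩
      obtain ⟨Y, rfl⟩ := mk_surjective s
      rw [hZ] at h0 h1
      have h : X.val.mulVec (Y.val.mulVec v) = c' • Y.val.mulVec v := by
        ext i
        fin_cases i
        · exact h0
        · exact h1
      obtain ⟨b, hb⟩ := (mk_mem_stabilizer_iff_exists hv0 Y).mp hs
      have hb0 := mulVec_ne_zero Y hv0
      rw [hb] at h hb0
      rw [Matrix.mulVec_smul, hXv, smul_comm] at h
      exact hne (smul_left_injective K hb0 h).symm

/-- The last nontrivial term of the derived series is abelian and normal, so any `d ≠ 1` in it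
commutes with its conjugates. -/
theorem exists_le_stabilizer_of_isSolvable [IsAlgClosed K] {S : Subgroup PGL(2, K)}
    (hS : IsZConnected (coordPGL k K 2) (S : Set PGL(2, K))) (hsol : Group.IsSolvable S) :
    ∃ p : ℙ K (Fin 2 → K), S ≤ MulAction.stabilizer PGL(2, K) p := by
  classical
  by_cases hbot : S = ⊥
  · obtain ⟨p⟩ : Nonempty (ℙ K (Fin 2 → K)) := inferInstance
    exact ⟨p, hbot ▸ bot_le⟩
  have hex := hsol.solvable
  obtain ⟨m, hm⟩ : ∃ m, Nat.find hex = m + 1 := by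
    refine Nat.exists_eq_succ_of_ne_zero fun h0 => hbot ?_
    have h := Nat.find_spec hex
    rw [h0, derivedSeries_zero] at h
    rw [← Subgroup.range_subtype S, MonoidHom.range_eq_map, h, Subgroup.map_bot]
  have hm1 : derivedSeries S (m + 1) = ⊥ := hm ▸ Nat.find_spec hex
  have hm0 : derivedSeries S m ≠ ⊥ := Nat.find_min hex (by omega)
  obtain ⟨⟨d, hdm⟩, hd⟩ := Subgroup.ne_bot_iff_exists_ne_one.mp hm0
  refine exists_le_stabilizer_of_commute_conj hS (d := d.1) (fun h => hd (Subtype.ext (Subtype.ext h))) ?_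
  intro s hs
  have hn : (⟨s, hs⟩ : S)⁻¹ * d * (⟨s, hs⟩ : S) ∈ derivedSeries S m := by
    simpa using (derivedSeries_normal S m).conj_mem d hdm (⟨s, hs⟩ : S)⁻¹
  have h1 := Subgroup.commutator_mem_commutator hn hdm
  rw [← derivedSeries_succ, hm1, Subgroup.mem_bot, commutatorElement_eq_one_iff_mul_comm] at h1
  exact congrArg Subtype.val h1

theorem exists_eq_stabilizer_of_isBorel [IsAlgClosed K] {B : Subgroup PGL(2, K)}
    (hB : IsBorel (coordPGL k K 2) B) :
    ∃ p : ℙ K (Fin 2 → K), B = MulAction.stabilizer PGL(2, K) p := by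
  obtain ⟨p, hp⟩ := exists_le_stabilizer_of_isSolvable hB.prop.2.1 hB.prop.2.2
  exact ⟨p, hB.eq_of_le
    ⟨isZClosed_stabilizer p, isZConnected_stabilizer p, isSolvable_stabilizer p⟩ hp⟩

theorem eq_stabilizer_or_eq_top_of_isParabolic [IsAlgClosed K] {P : Subgroup PGL(2, K)}
    (hP : IsParabolic (coordPGL k K 2) P) :
    (∃ p : ℙ K (Fin 2 → K), P = MulAction.stabilizer PGL(2, K) p) ∨ P = ⊤ := by
  obtain ⟨-, B, hB, hle⟩ := hP
  obtain ⟨p, rfl⟩ := exists_eq_stabilizer_of_isBorel hB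
  rcases (isCoatom_stabilizer p).le_iff.mp hle with h | h
  · exact Or.inr h
  · exact Or.inl ⟨p, h⟩

end CharTwo

/-! ### Fields of definition -/

section FieldOfDefinition

variable {k K : Type*} [Field k] [Field K] [Algebra k K]

theorem exists_eq_sum_basis_smul_of_mem_span {G ι : Type*} (b : Module.Basis ι k K)
    (A : Submodule k (G → K)) {f : G → K} (hf : f ∈ Submodule.span K (A : Set (G → K))) :
    ∃ h : ι →₀ A, f = h.sum fun i x => b i • (x : G → K) := by
  let Φ : (ι →₀ A) →ₗ[k] (G → K) := Finsupp.lsum k fun i =>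
    ((LinearMap.lsmul K (G → K) (b i)).restrictScalars k) ∘ₗ A.subtype
  have hΦ : ∀ h, Φ h = h.sum fun i x => b i • (x : G → K) := fun h => rfl
  suffices hf : f ∈ LinearMap.range Φ by
    obtain ⟨h, rfl⟩ := hf
    exact ⟨h, hΦ h⟩
  induction hf using Submodule.closure_induction with
  | zero => exact zero_mem _
  | add f f' _ _ h h' => exact add_mem h h'
  | smul_mem c g hg =>
    have : c • g = (b.repr c).sum fun i t => t • (b i • g) := by
      conv_lhs => rw [← b.linearCombination_repr c, Finsupp.linearCombination_apply]
      simp only [Finsupp.sum, Finset.sum_smul, smul_assoc]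
    rw [this]
    refine Submodule.sum_mem _ fun i _ => Submodule.smul_mem _ _ ⟨Finsupp.single i ⟨g, hg⟩, ?_⟩
    rw [hΦ, Finsupp.sum_single_index (by simp)]

/-- A closed subset of `PGL_n` parametrized by a polynomial matrix over `k` is defined over `k`. -/
theorem isDefinedOver_of_parametrization {n : ℕ} {σ : Type*} [Infinite K]
    (φ : Matrix (Fin n) (Fin n) (MvPolynomial σ k)) (hφ : φ.det ≠ 0) {Z : Set PGL(n, K)}
    (hcl : IsZClosed (coordPGL k K n) Z)
    (hZ : Z = {g | ∃ (M : GL (Fin n) K) (v : σ → K),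
      M.val = φ.map (MvPolynomial.aeval v) ∧ mk M = g}) :
    IsDefinedOver (coordPGL k K n) Z := by
  refine ⟨hcl, fun f hf hfZ => ?_⟩
  let b := Module.Basis.ofVectorSpace k K
  have hf' : f ∈ Submodule.span K
      ((Subalgebra.toSubmodule (coordPGL k K n) : Submodule k _) : Set (PGL(n, K) → K)) := by
    have : f ∈ Subalgebra.toSubmodule (regular (coordPGL k K n)) := hf
    rw [regular_eq_span] at this
    exact this
  obtain ⟨h, rfl⟩ := exists_eq_sum_basis_smul_of_mem_span b _ hf'
  have hdet : ∀ (v : σ → K), MvPolynomial.aeval v φ.det = (φ.map (MvPolynomial.aeval v)).det := by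
    intro v
    rw [AlgHom.map_det]
    rfl
  choose N p hp using fun i => exists_eval_eq_of_mem_coordPGL (K := K) φ (h i).2
  let m := ∑ i ∈ h.support, N i
  have hm : ∀ i ∈ h.support, N i ≤ m := fun i hi =>
    Finset.single_le_sum (f := N) (fun _ _ => Nat.zero_le _) hi
  let q : _ → MvPolynomial σ k := fun i => p i * φ.det ^ (m - N i)
  have hq : ∀ i ∈ h.support, ∀ (v : σ → K) (M : GL (Fin n) K),
      M.val = φ.map (MvPolynomial.aeval v) →
        (h i : PGL(n, K) → K) (mk M) * M.val.det ^ m = MvPolynomial.aeval v (q i) := by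
    intro i hi v M hM
    rw [map_mul, map_pow, ← hp i _ M hM, hdet, ← hM, mul_assoc, ← pow_add,
      Nat.add_sub_cancel' (hm i hi)]
  -- The pullback of `f` with denominators cleared. It vanishes identically, and independence of the
  -- `b i` over `k` then kills each `q i` separately.
  let Q : MvPolynomial σ K :=
    ∑ i ∈ h.support, MvPolynomial.C (b i) * MvPolynomial.map (algebraMap k K) (q i)
  have hQ : Q * MvPolynomial.map (algebraMap k K) φ.det = 0 := by
    refine MvPolynomial.funext fun v => ?_
    rw [map_mul, map_zero, MvPolynomial.eval_map, ← MvPolynomial.aeval_def, hdet]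
    by_cases hd : (φ.map (MvPolynomial.aeval v)).det = 0
    · rw [hd, mul_zero]
    let M : GL (Fin n) K := Matrix.GeneralLinearGroup.mkOfDetNeZero _ hd
    have hM : M.val = φ.map (MvPolynomial.aeval v) := rfl
    have h0 := hfZ (mk M) (hZ ▸ ⟨M, v, hM, rfl⟩)
    have : MvPolynomial.eval v Q = 0 := by
      simp only [Q, map_sum, map_mul, MvPolynomial.eval_C, MvPolynomial.eval_map]
      calc _ = ∑ i ∈ h.support, b i * ((h i : PGL(n, K) → K) (mk M) * M.val.det ^ m) := by
            refine Finset.sum_congr rfl fun i hi => ?_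
            rw [hq i hi v M hM, MvPolynomial.aeval_def]
        _ = (∑ i ∈ h.support, b i * (h i : PGL(n, K) → K) (mk M)) * M.val.det ^ m := by
            rw [Finset.sum_mul]
            exact Finset.sum_congr rfl fun i _ => (mul_assoc _ _ _).symm
        _ = 0 := by
            simp only [Finsupp.sum, Finset.sum_apply, Pi.smul_apply, smul_eq_mul] at h0
            rw [h0, zero_mul]
    rw [this, zero_mul]
  have hQ0 : Q = 0 := by
    refine (mul_eq_zero.mp hQ).resolve_right fun h => hφ ?_
    exact MvPolynomial.map_injective _ (algebraMap k K).injective (by rw [h, map_zero])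
  have hq0 : ∀ i ∈ h.support, q i = 0 := by
    intro i hi
    ext s
    have hs : ∑ i ∈ h.support, MvPolynomial.coeff s (q i) • b i = 0 := by
      have := congrArg (MvPolynomial.coeff s) hQ0
      simp only [Q, MvPolynomial.coeff_sum, MvPolynomial.coeff_C_mul, MvPolynomial.coeff_map,
        MvPolynomial.coeff_zero] at this
      rw [← this]
      exact Finset.sum_congr rfl fun i _ => by rw [Algebra.smul_def, mul_comm]
    rw [MvPolynomial.coeff_zero]
    exact linearIndependent_iff'.mp b.linearIndependent _ _ hs i hi
  refine Submodule.sum_mem _ fun i hi => Submodule.smul_mem _ _ (Submodule.subset_span ⟨(h i).2, ?_⟩)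
  intro z hz
  rw [hZ] at hz
  obtain ⟨M, v, hM, rfl⟩ := hz
  have h1 := hq i hi v M hM
  rw [hq0 i hi, map_zero] at h1
  have hd : M.val.det ≠ 0 := ((Matrix.isUnit_iff_isUnit_det _).mp M.isUnit).ne_zero
  exact (mul_eq_zero.mp h1).resolve_right (pow_ne_zero _ hd)

/-- As `z` is not in `k`, `r` is a multiple of `X ^ 2 - c`, whose derivative `2X` is zero. -/
theorem aeval_derivative_eq_zero_of_sq_mem [CharP k 2] {z : K} {c : k}
    (hz : z ^ 2 = algebraMap k K c) (hzk : ∀ b : k, algebraMap k K b ≠ z) {r : Polynomial k}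
    (hr : Polynomial.aeval z r = 0) : Polynomial.aeval z (Polynomial.derivative r) = 0 := by
  open Polynomial in
  have hmonic : (X ^ 2 - C c : k[X]).Monic := monic_X_pow_sub_C c two_ne_zero
  obtain ⟨u, w, huw⟩ : ∃ u w : k, r %ₘ (X ^ 2 - C c) = C u * X + C w := by
    refine exists_eq_X_add_C_of_natDegree_le_one ?_
    have := natDegree_modByMonic_lt r hmonic (by
      intro h
      have := congrArg natDegree h
      rw [natDegree_X_pow_sub_C, natDegree_one] at this
      omega)
    rw [natDegree_X_pow_sub_C] at this
    omega
  have hdiv := modByMonic_add_div r (X ^ 2 - C c : k[X])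
  have hzero : aeval z (X ^ 2 - C c : k[X]) = 0 := by simp [hz]
  have h1 : algebraMap k K u * z + algebraMap k K w = 0 := by
    have := congrArg (aeval z) hdiv
    rw [map_add, map_mul, hzero, zero_mul, add_zero, hr, huw] at this
    simpa using this
  have hu : u = 0 := by
    by_contra hu
    refine hzk (-w / u) ?_
    have : algebraMap k K u ≠ 0 := by simpa using hu
    rw [map_div₀, map_neg]
    field_simp
    linear_combination -h1
  have hw : w = 0 := by simpa [hu] using h1
  rw [huw, hu, hw] at hdiv
  rw [← hdiv]
  have h2 : (1 + 1 : K) = 0 := by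
    rw [← map_one (algebraMap k K), ← map_add, CharTwo.add_self_eq_zero, map_zero]
  simp [hz, h2]

theorem not_isDefinedOver_stabilizer [CharP k 2] {a : k} (ha : ¬ IsSquare a) {α : K}
    (hα : α ^ 2 = algebraMap k K a) :
    ¬ IsDefinedOver (coordPGL k K 2)
      (MulAction.stabilizer PGL(2, K) (Projectivization.mk K ![α, 1] (by simp)) :
        Set PGL(2, K)) := by
  rintro ⟨-, hdef⟩
  have ha0 : a ≠ 0 := by
    rintro rfl
    exact ha (IsSquare.zero)
  have ha1 : a + 1 ≠ 0 := by
    intro h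
    rw [CharTwo.add_eq_zero] at h
    exact ha (h ▸ IsSquare.one)
  have haK : algebraMap k K a ≠ 0 := by simpa using ha0
  -- A curve over `k` meeting the stabilizer only at `z₀ = α (a - 1)`. The corner entry `a`,
  -- different from 1, keeps `z₀` outside `k`.
  let g : K → GL (Fin 2) K := fun z =>
    Matrix.GeneralLinearGroup.mkOfDetNeZero !![1, z; 0, algebraMap k K a] (by simpa using ha0)
  have hg : ∀ z, (g z).val = !![1, z; 0, algebraMap k K a] := fun z => rfl
  have hgdet : ∀ z, (g z).val.det = algebraMap k K a := fun z => by simp [hg]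
  let z₀ : K := α * (algebraMap k K a - 1)
  have hz₀ : z₀ ^ 2 = algebraMap k K (a * (a - 1) ^ 2) := by
    simp only [z₀, mul_pow, hα, map_mul, map_pow, map_sub, map_one]
  have hz₀k : ∀ b : k, algebraMap k K b ≠ z₀ := by
    intro b hb
    have ha1' : a - 1 ≠ 0 := by rwa [CharTwo.sub_eq_add]
    have : b ^ 2 = a * (a - 1) ^ 2 := by
      apply (algebraMap k K).injective
      rw [map_pow, hb, hz₀]
    refine ha ⟨b / (a - 1), ?_⟩
    field_simp
    exact this.symm
  have hmem : ∀ M : GL (Fin 2) K, mk M ∈ (MulAction.stabilizer PGL(2, K)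
      (Projectivization.mk K ![α, 1] (by simp)) : Set PGL(2, K)) ↔
      α * (M.val 1 0 * α + M.val 1 1) - (M.val 0 0 * α + M.val 0 1) = 0 := by
    intro M
    rw [SetLike.mem_coe, mk_mem_stabilizer_iff]
    simp [Matrix.mulVec, dotProduct]
  let f : PGL(2, K) → K := α ^ 2 • quadFn K 1 0 0 0 + α • quadFn K 1 1 0 0 -
    α • quadFn K 0 0 0 0 - quadFn K 0 1 0 0
  have hf : ∀ M : GL (Fin 2) K, f (mk M) =
      (α * (M.val 1 0 * α + M.val 1 1) - (M.val 0 0 * α + M.val 0 1)) * M.val 0 0 *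
        (M.val.det)⁻¹ := by
    intro M
    simp only [f, Pi.add_apply, Pi.sub_apply, Pi.smul_apply, quadFn_mk, smul_eq_mul]
    ring
  have hspan := hdef f
    (sub_mem (sub_mem (add_mem (Subalgebra.smul_mem _ (quadFn_mem_regular _ _ _ _) _)
      (Subalgebra.smul_mem _ (quadFn_mem_regular _ _ _ _) _))
      (Subalgebra.smul_mem _ (quadFn_mem_regular _ _ _ _) _)) (quadFn_mem_regular _ _ _ _))
    (by
      intro z hz
      obtain ⟨M, rfl⟩ := mk_surjective z
      rw [hf, (hmem M).mp hz, zero_mul, zero_mul])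
  -- A vanishing derivative at `z₀` survives `K`-linear combinations, yet `f` restricts to `(z₀ - z)
  -- / a`, with a simple zero there.
  have hfr : ∃ r : Polynomial K, (∀ z, f (mk (g z)) = r.eval z) ∧
      r.derivative.eval z₀ = 0 := by
    clear_value f
    clear hf
    induction hspan using Submodule.span_induction with
    | zero => exact ⟨0, by simp, by simp⟩
    | add f f' _ _ h h' =>
      obtain ⟨r, hr, hr0⟩ := h
      obtain ⟨r', hr', hr0'⟩ := h'
      exact ⟨r + r', by simp [hr, hr'], by simp [hr0, hr0']⟩
    | smul c f _ h =>
      obtain ⟨r, hr, hr0⟩ := h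
      exact ⟨Polynomial.C c * r, by simp [hr], by simp [hr0]⟩
    | mem h hh =>
      obtain ⟨hA, hP⟩ := hh
      obtain ⟨N, r, hr⟩ := exists_eval_eq_of_mem_coordPGL (K := K)
        !![1, Polynomial.X; 0, Polynomial.C a] hA
      have hr : ∀ z, h (mk (g z)) * algebraMap k K a ^ N = Polynomial.aeval z r := by
        intro z
        rw [← hgdet z]
        refine hr (Polynomial.aeval z) (g z) ?_
        rw [hg]
        ext i j
        fin_cases i <;> fin_cases j <;> simp
      have hr0 : Polynomial.aeval z₀ r = 0 := by
        rw [← hr, hP _ ((hmem _).mpr ?_), zero_mul]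
        simp [hg, z₀]
        ring
      refine ⟨Polynomial.C ((algebraMap k K a ^ N)⁻¹) * r.map (algebraMap k K), fun z => ?_, ?_⟩
      · rw [Polynomial.eval_mul, Polynomial.eval_C, Polynomial.eval_map, ← Polynomial.aeval_def,
          ← hr]
        field_simp
      · rw [Polynomial.derivative_C_mul, Polynomial.derivative_map, Polynomial.eval_mul,
          Polynomial.eval_map, ← Polynomial.aeval_def,
          aeval_derivative_eq_zero_of_sq_mem hz₀ hz₀k hr0, mul_zero]
  obtain ⟨r, hr, hr0⟩ := hfr
  have hK : Infinite K := by
    by_contra h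
    have := not_infinite_iff_finite.mp h
    have : Finite k := Finite.of_injective _ (algebraMap k K).injective
    have hsq := (Finite.injective_iff_surjective (f := frobenius k 2)).mp (frobenius_inj k 2)
    obtain ⟨b, hb⟩ := hsq a
    exact ha ⟨b, by rw [← hb, frobenius_def, sq]⟩
  have hrr : r = Polynomial.C ((algebraMap k K a)⁻¹) * (Polynomial.C z₀ - Polynomial.X) := by
    refine Polynomial.funext fun z => ?_
    rw [← hr, hf, hgdet]
    simp [hg, z₀]
    ring
  rw [hrr] at hr0
  simp [ha0] at hr0

end FieldOfDefinition

/-! ### Unipotent elements and the unipotent radical of `PGL₂` -/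

section Unipotent

variable {k K : Type*} [Field k] [Field K] [Algebra k K]

theorem mk_mul_self_of_trace_eq_zero {M : GL (Fin 2) K} (h : M.val.trace = 0) :
    mk M * mk M = 1 := by
  rw [← map_mul, ← map_one mk, eq_comm, mk_eq_mk_iff_smul]
  refine ⟨-M.val.det, neg_ne_zero.mpr (det_ne_zero M), ?_⟩
  rw [Matrix.trace_fin_two] at h
  have h1 : M.val 1 1 = -M.val 0 0 := by linear_combination h
  ext i j
  fin_cases i <;> fin_cases j <;>
    simp [Matrix.mul_apply, Fin.sum_univ_two, Matrix.det_fin_two, h1] <;> ring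

theorem rightTranslation_pow_apply {G : Type*} [Group G] (g x : G) (f : G → K) (n : ℕ) :
    ((rightTranslation K g) ^ n) f x = f (x * g ^ n) := by
  induction n generalizing x with
  | zero => simp
  | succ n ih =>
    rw [pow_succ', Module.End.mul_apply]
    change ((rightTranslation K g) ^ n) f (x * g) = _
    rw [ih, mul_assoc, ← pow_succ']

theorem trace_pow_two_pow [CharP K 2] (M : Matrix (Fin 2) (Fin 2) K) (m : ℕ) :
    (M ^ 2 ^ m).trace = M.trace ^ 2 ^ m := by
  induction m with
  | zero => simp
  | succ m ih =>
    rw [pow_succ 2 m, pow_mul, pow_mul, ← ih]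
    generalize M ^ 2 ^ m = N
    simp only [sq, Matrix.trace_fin_two, Matrix.mul_apply, Fin.sum_univ_two]
    linear_combination (N 0 1 * N 1 0 - N 0 0 * N 1 1) * CharTwo.two_eq_zero (R := K)

theorem isUnipotentElement_of_mul_self {G : Type*} [Group G] [CharP K 2]
    (A : Subalgebra k (G → K)) {g : G} (hg : g * g = 1) : IsUnipotentElement A g := by
  intro f _
  refine ⟨2, ?_⟩
  funext x
  have : f (x * g * g) = f x := by rw [mul_assoc, hg, mul_one]
  simp only [sq, Module.End.mul_apply, LinearMap.sub_apply, Module.End.one_apply, map_sub,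
    Pi.sub_apply, rightTranslation, LinearMap.funLeft_apply, this, Pi.zero_apply]
  linear_combination (f x - f (x * g)) * CharTwo.two_eq_zero (R := K)

/-- In characteristic 2, `(T - 1) ^ 2 ^ m = T ^ 2 ^ m - 1`. -/
theorem apply_pow_two_pow_eq_of_sub_one_pow_apply_eq_zero {V : Type*} [AddCommGroup V]
    [Module K V] [CharP K 2] {T : Module.End K V} {v : V} {n m : ℕ} (hn : n ≤ 2 ^ m)
    (h : ((T - 1) ^ n) v = 0) : (T ^ 2 ^ m) v = v := by
  by_cases hv : v = 0
  · rw [hv, map_zero]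
  have : Nontrivial V := ⟨v, 0, hv⟩
  have : CharP (Module.End K V) 2 :=
    charP_of_injective_algebraMap (algebraMap K (Module.End K V)).injective 2
  have h0 : ((T - 1 : Module.End K V) ^ 2 ^ m) v = 0 := by
    rw [← Nat.sub_add_cancel hn, pow_add, Module.End.mul_apply, h, map_zero]
  have h1 : (T - 1) ^ 2 ^ m = T ^ 2 ^ m - 1 ^ 2 ^ m :=
    sub_pow_char_pow_of_commute 2 m (Commute.one_right T)
  rwa [h1, one_pow, LinearMap.sub_apply, Module.End.one_apply, sub_eq_zero] at h0

/-- Some `g ^ 2 ^ m` agrees with 1 on all `quadFn`, so its lift has equal diagonal entries and trace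
zero. The trace commutes with this power, so `M` has trace zero too. -/
theorem mul_self_of_isUnipotentElement [CharP K 2] {g : PGL(2, K)}
    (hg : IsUnipotentElement (coordPGL k K 2) g) : g * g = 1 := by
  choose n hn using fun p : Fin 2 × Fin 2 × Fin 2 × Fin 2 =>
    hg _ (quadFn_mem_regular (k := k) (K := K) p.1 p.2.1 p.2.2.1 p.2.2.2)
  obtain ⟨m, hm⟩ : ∃ m, ∀ p, n p ≤ 2 ^ m := ⟨∑ p, n p, fun p =>
    (Finset.single_le_sum (fun _ _ => Nat.zero_le _) (Finset.mem_univ p)).trans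
      Nat.lt_two_pow_self.le⟩
  have hq : ∀ i j l p, quadFn K i j l p (g ^ 2 ^ m) = quadFn K i j l p 1 := by
    intro i j l p
    have h := apply_pow_two_pow_eq_of_sub_one_pow_apply_eq_zero (hm (i, j, l, p)) (hn (i, j, l, p))
    have := congrFun h 1
    rwa [rightTranslation_pow_apply, one_mul] at this
  obtain ⟨M, rfl⟩ := mk_surjective g
  apply mk_mul_self_of_trace_eq_zero
  have h0 : ∀ i j l p, (M ^ 2 ^ m).val i j * (M ^ 2 ^ m).val l p * ((M ^ 2 ^ m).val.det)⁻¹ =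
      (1 : Matrix (Fin 2) (Fin 2) K) i j * (1 : Matrix (Fin 2) (Fin 2) K) l p := by
    intro i j l p
    have := hq i j l p
    rw [← map_pow, ← map_one mk, quadFn_mk, quadFn_mk] at this
    simpa using this
  have hd := det_ne_zero (M ^ 2 ^ m)
  have h1 := (h0 0 0 0 0).trans (h0 0 0 1 1).symm
  have h2 := h0 0 0 0 0
  have htr : (M ^ 2 ^ m).val.trace = 0 := by
    have h00 : (M ^ 2 ^ m).val 0 0 ≠ 0 := by
      intro h
      rw [h] at h2
      simp at h2
    have := mul_left_cancel₀ h00 (mul_right_cancel₀ (inv_ne_zero hd) h1)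
    rw [Matrix.trace_fin_two, ← this, CharTwo.add_self_eq_zero]
  rw [Units.val_pow_eq_pow_val, trace_pow_two_pow] at htr
  exact pow_eq_zero_iff (by positivity) |>.mp htr

theorem isZConnected_top [Infinite K] :
    IsZConnected (coordPGL k K 2) ((⊤ : Subgroup PGL(2, K)) : Set PGL(2, K)) :=
  isZConnected_of_submodule ⊤ (by simp) ⟨1, by simp⟩

/-- A normal unipotent subgroup has exponent 2, hence is abelian. A nontrivial element would commute
with its conjugates and force `PGL₂` to fix a point. -/
theorem unipotentRadical_top [CharP K 2] [IsAlgClosed K] :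
    unipotentRadical (coordPGL k K 2) (⊤ : Subgroup PGL(2, K)) = ⊥ := by
  have : Infinite K := IsAlgClosed.instInfinite
  refine sSup_eq_bot.mpr ?_
  rintro N ⟨-, hnorm, -, -, hun⟩
  rw [Subgroup.eq_bot_iff_forall]
  intro d hd
  by_contra hd1
  have hsq : ∀ g ∈ N, g * g = 1 := fun g hg =>
    mul_self_of_isUnipotentElement (k := k) fun f hf => hun g hg f (Algebra.subset_adjoin hf)
  obtain ⟨p, hp⟩ := exists_le_stabilizer_of_commute_conj (k := k) isZConnected_top hd1 (by
    intro s _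
    have h1 : s⁻¹ * d * s ∈ N := by
      have := hnorm.conj_mem ⟨d, Subgroup.mem_top d⟩ hd ⟨s⁻¹, Subgroup.mem_top _⟩
      simpa [Subgroup.mem_subgroupOf] using this
    have hx := eq_inv_of_mul_eq_one_left (hsq _ h1)
    have hy := eq_inv_of_mul_eq_one_left (hsq _ hd)
    have hxy := eq_inv_of_mul_eq_one_left (hsq _ (mul_mem h1 hd))
    rw [mul_inv_rev, ← hx, ← hy] at hxy
    exact hxy)
  exact (isCoatom_stabilizer p).1 (top_le_iff.mp hp)

theorem isKLevi_top [CharP K 2] [IsAlgClosed K] :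
    IsKLevi (coordPGL k K 2) (⊤ : Subgroup PGL(2, K)) ⊤ := by
  have hcl : IsZClosed (coordPGL k K 2) ((⊤ : Subgroup PGL(2, K)) : Set PGL(2, K)) := by
    let := zariski (coordPGL k K 2)
    exact isClosed_univ
  refine ⟨⟨hcl, by simp [unipotentRadical_top], by simp, fun f hf => ⟨f, hf, ?_⟩⟩, hcl, ?_⟩
  · intro l _ u hu
    rw [unipotentRadical_top, Subgroup.mem_bot] at hu
    rw [hu, mul_one]
  · intro f _ hf0
    have : f = 0 := funext fun g => hf0 g (Subgroup.mem_top g)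
    rw [this]
    exact zero_mem _

end Unipotent

/-! ### The subgroup `H` and its fixed point -/

section QuadraticSubgroup

variable {k K : Type*} [Field k] [Field K] [Algebra k K]

/-- The image in `PGL₂(K)` of the invertible matrices `!![x, b * y; y, x]`. -/
def quadraticSubgroup (b : K) : Subgroup PGL(2, K) where
  carrier := {g | ∃ M : GL (Fin 2) K, mk M = g ∧ M.val 0 0 = M.val 1 1 ∧
    M.val 0 1 = b * M.val 1 0}
  one_mem' := ⟨1, map_one _, by simp, by simp⟩
  mul_mem' := by
    rintro _ _ ⟨M, rfl, h1, h2⟩ ⟨N, rfl, h1', h2'⟩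
    refine ⟨M * N, map_mul _ _ _, ?_, ?_⟩
    all_goals
      simp only [Units.val_mul, Matrix.mul_apply, Fin.sum_univ_two, h1, h2, h1', h2']
      ring
  inv_mem' := by
    rintro _ ⟨M, rfl, h1, h2⟩
    refine ⟨M⁻¹, map_inv _ _, ?_, ?_⟩
    all_goals
      rw [Matrix.coe_units_inv, Matrix.inv_def, Matrix.adjugate_fin_two]
      simp [h1, h2]
    ring

theorem mk_mem_quadraticSubgroup {b : K} (M : GL (Fin 2) K) :
    mk M ∈ quadraticSubgroup b ↔ M.val 0 0 = M.val 1 1 ∧ M.val 0 1 = b * M.val 1 0 := by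
  constructor
  · rintro ⟨N, h, h1, h2⟩
    obtain ⟨c, -, hc⟩ := mk_eq_mk_iff_smul.mp h
    simp only [hc, Matrix.smul_apply, smul_eq_mul, h1, h2]
    exact ⟨trivial, by ring⟩
  · exact fun h => ⟨M, rfl, h⟩

theorem coe_quadraticSubgroup (b : K) :
    (quadraticSubgroup b : Set PGL(2, K)) = {h | ∃ (M : GL (Fin 2) K) (x y : K),
      (M : Matrix (Fin 2) (Fin 2) K) = !![x, b * y; y, x] ∧ mk M = h} := by
  ext g
  constructor
  · rintro ⟨M, rfl, h1, h2⟩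
    refine ⟨M, M.val 0 0, M.val 1 0, ?_, rfl⟩
    ext i j
    fin_cases i <;> fin_cases j <;> simp [h1, h2]
  · rintro ⟨M, x, y, h, rfl⟩
    exact ⟨M, rfl, by simp [h], by simp [h]⟩

theorem isZClosed_quadraticSubgroup (b : K) :
    IsZClosed (coordPGL k K 2) (quadraticSubgroup b : Set PGL(2, K)) := by
  let := zariski (coordPGL k K 2)
  have h1 : IsZClosed (coordPGL k K 2) {g : PGL(2, K) | ∃ M : GL (Fin 2) K, mk M = g ∧
      M.val 0 0 = M.val 1 1} := by
    refine isZClosed_of_linear 1 0 0 (-1) fun M => ?_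
    constructor
    · rintro ⟨N, h, h1⟩
      obtain ⟨c, -, hc⟩ := mk_eq_mk_iff_smul.mp h
      simp [hc, h1]
    · exact fun h => ⟨M, rfl, by linear_combination h⟩
  have h2 : IsZClosed (coordPGL k K 2) {g : PGL(2, K) | ∃ M : GL (Fin 2) K, mk M = g ∧
      M.val 0 1 = b * M.val 1 0} := by
    refine isZClosed_of_linear 0 1 (-b) 0 fun M => ?_
    constructor
    · rintro ⟨N, h, h1⟩
      obtain ⟨c, -, hc⟩ := mk_eq_mk_iff_smul.mp h
      simp only [hc, h1, Matrix.smul_apply, smul_eq_mul]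
      ring
    · exact fun h => ⟨M, rfl, by linear_combination h⟩
  suffices h : (quadraticSubgroup b : Set PGL(2, K)) = {g | ∃ M : GL (Fin 2) K, mk M = g ∧
      M.val 0 0 = M.val 1 1} ∩ {g | ∃ M : GL (Fin 2) K, mk M = g ∧ M.val 0 1 = b * M.val 1 0} by
    rw [h]
    exact IsClosed.inter h1 h2
  ext g
  constructor
  · rintro ⟨M, rfl, h, h'⟩
    exact ⟨⟨M, rfl, h⟩, ⟨M, rfl, h'⟩⟩
  · rintro ⟨⟨M, rfl, h⟩, ⟨N, hN, h'⟩⟩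
    refine ⟨M, rfl, h, ?_⟩
    obtain ⟨c, -, hc⟩ := mk_eq_mk_iff_smul.mp hN
    simp only [hc, h', Matrix.smul_apply, smul_eq_mul]
    ring

theorem isDefinedOver_quadraticSubgroup [Infinite K] (a : k) :
    IsDefinedOver (coordPGL k K 2)
      (quadraticSubgroup (algebraMap k K a) : Set PGL(2, K)) := by
  refine isDefinedOver_of_parametrization (σ := Fin 2)
    !![.X 0, .C a * .X 1; .X 1, .X 0] ?_ (isZClosed_quadraticSubgroup _) ?_
  · intro h
    have := congrArg (MvPolynomial.eval ![1, 0]) h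
    simp [Matrix.det_fin_two] at this
  · rw [coe_quadraticSubgroup]
    have key : ∀ v : Fin 2 → K, (!![.X 0, .C a * .X 1; .X 1, .X 0] :
        Matrix (Fin 2) (Fin 2) (MvPolynomial (Fin 2) k)).map (MvPolynomial.aeval v) =
        !![v 0, algebraMap k K a * v 1; v 1, v 0] := by
      intro v
      ext i j
      fin_cases i <;> fin_cases j <;> simp
    ext g
    constructor
    · rintro ⟨M, x, y, h, rfl⟩
      exact ⟨M, ![x, y], by rw [key, h]; simp, rfl⟩
    · rintro ⟨M, v, h, rfl⟩
      exact ⟨M, v 0, v 1, by rw [h, key], rfl⟩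

theorem isZConnected_quadraticSubgroup [Infinite K] (b : K) :
    IsZConnected (coordPGL k K 2) (quadraticSubgroup b : Set PGL(2, K)) :=
  isZConnected_of_submodule
    { carrier := {M | M 0 0 = M 1 1 ∧ M 0 1 = b * M 1 0}
      zero_mem' := by simp
      add_mem' := by
        rintro M N ⟨h1, h2⟩ ⟨h1', h2'⟩
        exact ⟨by simp [h1, h1'], by simp [h2, h2', mul_add]⟩
      smul_mem' := by
        rintro c M ⟨h1, h2⟩
        exact ⟨by simp [h1], by simp [h2, mul_left_comm]⟩ }
    mk_mem_quadraticSubgroup ⟨1, one_mem _⟩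

theorem isUnipotentSubgroup_quadraticSubgroup [CharP K 2] (b : K) :
    IsUnipotentSubgroup (coordPGL k K 2) (quadraticSubgroup b) := by
  rintro _ ⟨M, rfl, h, -⟩
  refine isUnipotentElement_of_mul_self _ (mk_mul_self_of_trace_eq_zero ?_)
  rw [Matrix.trace_fin_two, h, CharTwo.add_self_eq_zero]

theorem exists_mk_mem_quadraticSubgroup {b : K} (hb : b ≠ 0) :
    ∃ M : GL (Fin 2) K, M.val = !![0, b; 1, 0] ∧ mk M ∈ quadraticSubgroup b := by
  refine ⟨Matrix.GeneralLinearGroup.mkOfDetNeZero !![0, b; 1, 0] (by simpa using hb), rfl, ?_⟩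
  rw [mk_mem_quadraticSubgroup]
  simp [Matrix.GeneralLinearGroup.mkOfDetNeZero]

theorem quadraticSubgroup_ne_bot {b : K} (hb : b ≠ 0) : quadraticSubgroup b ≠ ⊥ := by
  intro h
  obtain ⟨M, hM, hmem⟩ := exists_mk_mem_quadraticSubgroup hb
  rw [h, Subgroup.mem_bot, ← map_one mk, eq_comm, mk_eq_mk_iff_smul] at hmem
  obtain ⟨c, -, hc⟩ := hmem
  have := congrFun (congrFun hc 1) 0
  simp [hM] at this

theorem eq_of_quadraticSubgroup_le_stabilizer [CharP K 2] {α : K} (hα : α ≠ 0)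
    {p : ℙ K (Fin 2 → K)} (hp : quadraticSubgroup (α ^ 2) ≤ MulAction.stabilizer PGL(2, K) p) :
    p = Projectivization.mk K ![α, 1] (by simp) := by
  obtain ⟨M, hM, hmem⟩ := exists_mk_mem_quadraticSubgroup (pow_ne_zero 2 hα)
  induction p using Projectivization.ind with | _ v hv =>
  have h := (mk_mem_stabilizer_iff hv M).mp (hp hmem)
  simp only [hM, Matrix.mulVec, dotProduct, Fin.sum_univ_two, Matrix.of_apply, Matrix.cons_val',
    Matrix.cons_val_zero, Matrix.cons_val_one, Matrix.cons_val_fin_one] at h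
  -- The fixed-point equation of `!![0, α ^ 2; 1, 0]` is a perfect square in characteristic 2.
  have h0 : (v 0 - α * v 1) ^ 2 = 0 := by
    linear_combination h + (α ^ 2 * v 1 ^ 2 - α * v 0 * v 1) * CharTwo.two_eq_zero (R := K)
  have h1 : v 0 = α * v 1 := sub_eq_zero.mp (pow_eq_zero_iff two_ne_zero |>.mp h0)
  rw [Projectivization.mk_eq_mk_iff']
  refine ⟨v 1, ?_⟩
  ext i
  fin_cases i
  · simp [h1, mul_comm]
  · simp

theorem isIrreducibleOver_quadraticSubgroup [CharP k 2] [CharP K 2] [IsAlgClosed K] {a : k}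
    (ha : ¬ IsSquare a) :
    IsIrreducibleOver (coordPGL k K 2) (quadraticSubgroup (algebraMap k K a)) := by
  rintro P ⟨hP, hdef⟩ hle
  obtain ⟨α, hα⟩ := IsAlgClosed.exists_pow_nat_eq (algebraMap k K a) two_pos
  have hα0 : α ≠ 0 := by
    rintro rfl
    have : a = 0 := by simpa using hα.symm
    exact ha (this ▸ IsSquare.zero)
  rcases eq_stabilizer_or_eq_top_of_isParabolic hP with ⟨p, rfl⟩ | h
  · rw [← hα] at hle
    rw [eq_of_quadraticSubgroup_le_stabilizer hα0 hle] at hdef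
    exact absurd hdef (not_isDefinedOver_stabilizer ha hα)
  · exact h

end QuadraticSubgroup

end AlgGrp

theorem mainTheorem7 (k K : Type*) [Field k] [CharP k 2] (hk : ¬ PerfectField k)
    [Field K] [Algebra k K] [IsAlgClosure k K] :
    (∃ a : k, ¬ IsSquare a) ∧
    ∀ a : k, ¬ IsSquare a →
      ∃ H : Subgroup PGL(2, K),
        (H : Set PGL(2, K)) =
          {h | ∃ (M : GL (Fin 2) K) (x y : K),
            (M : Matrix (Fin 2) (Fin 2) K) = !![x, algebraMap k K a * y; y, x] ∧
              Matrix.ProjGenLinGroup.mk M = h} ∧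
        AlgGrp.IsDefinedOver (AlgGrp.coordPGL k K 2) (H : Set PGL(2, K)) ∧
        AlgGrp.IsZConnected (AlgGrp.coordPGL k K 2) (H : Set PGL(2, K)) ∧
        AlgGrp.IsUnipotentSubgroup (AlgGrp.coordPGL k K 2) H ∧
        AlgGrp.IsIrreducibleOver (AlgGrp.coordPGL k K 2) H ∧
        AlgGrp.IsCompletelyReducibleOver (AlgGrp.coordPGL k K 2) H ∧
        ¬ AlgGrp.IsPseudoReductive (AlgGrp.coordPGL k K 2) H := by
  have hK : IsAlgClosed K := IsAlgClosure.isAlgClosed k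
  have hinf : Infinite K := IsAlgClosed.instInfinite
  have hchar : CharP K 2 := charP_of_injective_algebraMap (algebraMap k K).injective 2
  refine ⟨?_, fun a ha => ?_⟩
  · by_contra! h
    have : PerfectRing k 2 := PerfectRing.ofSurjective k 2 fun a => by
      obtain ⟨b, hb⟩ := h a
      exact ⟨b, by rw [frobenius_def, sq, hb]⟩
    exact hk (PerfectRing.toPerfectField k 2)
  have ha0 : algebraMap k K a ≠ 0 := by
    intro h
    have : a = 0 := by simpa using h
    exact ha (this ▸ IsSquare.zero)
  have hirr := AlgGrp.isIrreducibleOver_quadraticSubgroup (K := K) ha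
  have hdef := AlgGrp.isDefinedOver_quadraticSubgroup (K := K) a
  have hconn := AlgGrp.isZConnected_quadraticSubgroup (k := k) (algebraMap k K a)
  have hun := AlgGrp.isUnipotentSubgroup_quadraticSubgroup (k := k) (algebraMap k K a)
  refine ⟨AlgGrp.quadraticSubgroup (algebraMap k K a), AlgGrp.coe_quadraticSubgroup _, hdef,
    hconn, hun, hirr, fun P hP hle => ?_, fun h => ?_⟩
  · rw [hirr P hP hle]
    exact ⟨⊤, AlgGrp.isKLevi_top, le_top⟩
  · have hle : AlgGrp.quadraticSubgroup (algebraMap k K a) ≤ AlgGrp.kUnipotentRadical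
        (AlgGrp.coordPGL k K 2) (AlgGrp.quadraticSubgroup (algebraMap k K a)) :=
      le_sSup ⟨le_rfl, by rw [Subgroup.subgroupOf_self]; infer_instance, hdef, hconn, hun⟩
    rw [h.2.2] at hle
    exact AlgGrp.quadraticSubgroup_ne_bot ha0 (le_bot_iff.mp hle)
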